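/- For a signature $\sigma$, let $\mathrm{FO}(\subseteq_1)[\sigma]$ be unary inclusion logic under lax team semantics, that is, first-order logic (in negation normal form) extended by inclusion atoms $\vec t_1\subseteq\vec t_2$ of arity at most $1$, where a team $X$ satisfies $\vec t_1\subseteq\vec t_2$ iff for every $s\in X$ there is $s'\in X$ with $s(\vec t_1)=s'(\vec t_2)$. Let $\mathrm{FO}(\subseteq_1,\mathsf F)[\sigma]$ be its extension by the flattening operator $\mathsf F$, where $\mathfrak M\models_X\mathsf F\varphi$ iff $\mathfrak M\models_{\{s\}}\varphi$ for all $s\in X$. A sentence is true in $\mathfrak M$ if it is satisfied by the team consisting of the empty assignment only; models are non-empty. The flattening operator strictly increases the expressive power of unary inclusion logic: 1. Over every signature $\sigma$, every formula of $\mathrm{FO}(\subseteq_1)[\sigma]$ is equivalent, on all models and teams, to a formula of $\mathrm{FO}(\subseteq_1,\mathsf F)[\sigma]$; but over the signature $\{E\}$ of graphs, some sentence of $\mathrm{FO}(\subseteq_1,\mathsf F)$ is not equivalent to any sentence of $\mathrm{FO}(\subseteq_1)$. 2. There is a sentence of $\mathrm{FO}(\subseteq_1,\mathsf F)[\{E\}]$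 that is true in a (finite or infinite, simple, undirected, non-empty) graph $G=\langle V,E\rangle$ if and only if $G$ is disconnected. 3. There is no sentence of $\mathrm{FO}(\subseteq_1)[\{E\}]$ that is true in exactly the disconnected graphs, not even when only finite graphs are considered. -/

import Mathlib

universe u v w

/-- Formulas, in negation normal form, of inclusion logic extended by the flattening operator, over
the signature `L`. As in Mathlib's `BoundedFormula`, `TeamFormula L n` consists of the formulas
whose free variables are among `x 0, …, x (n - 1)`, and a quantifier binds the variable of index `n`
of its body. In particular `TeamFormula L 0` is the type of sentences. -/
inductive TeamFormula (L : FirstOrder.Language.{u, v}) : ℕ → Type (max u v)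
  /-- The literal `t₁ = t₂`. -/
  | eq {n : ℕ} (t₁ t₂ : L.Term (Fin n)) : TeamFormula L n
  /-- The literal `¬ t₁ = t₂`. -/
  | ne {n : ℕ} (t₁ t₂ : L.Term (Fin n)) : TeamFormula L n
  /-- The literal `R(t₁, …, tₖ)`. -/
  | rel {n k : ℕ} (R : L.Relations k) (t : Fin k → L.Term (Fin n)) : TeamFormula L n
  /-- The literal `¬ R(t₁, …, tₖ)`. -/
  | nrel {n k : ℕ} (R : L.Relations k) (t : Fin k → L.Term (Fin n)) : TeamFormula L n
  /-- The `k`-ary inclusion atom between two `k`-tuples of terms. -/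
  | incl {n k : ℕ} (t₁ t₂ : Fin k → L.Term (Fin n)) : TeamFormula L n
  | or {n : ℕ} (φ ψ : TeamFormula L n) : TeamFormula L n
  | and {n : ℕ} (φ ψ : TeamFormula L n) : TeamFormula L n
  | ex {n : ℕ} (φ : TeamFormula L (n + 1)) : TeamFormula L n
  | all {n : ℕ} (φ : TeamFormula L (n + 1)) : TeamFormula L n
  /-- The flattening operator `F φ`. -/
  | flat {n : ℕ} (φ : TeamFormula L n) : TeamFormula L n

namespace TeamFormula

/-- The supplementation `X[H/v]` of a team, where `v` is the variable of index `n`. -/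
def supplement {M : Type w} {n : ℕ} (X : Set (Fin n → M)) (H : (Fin n → M) → Set M) :
    Set (Fin (n + 1) → M) :=
  {s' | ∃ s ∈ X, ∃ m ∈ H s, s' = Fin.snoc (α := fun _ => M) s m}

/-- The duplication `X[M/v]` of a team, where `v` is the variable of index `n`. -/
def duplicate {M : Type w} {n : ℕ} (X : Set (Fin n → M)) : Set (Fin (n + 1) → M) :=
  {s' | ∃ s ∈ X, ∃ m : M, s' = Fin.snoc (α := fun _ => M) s m}

/-- Lax team semantics: the team `X`, a set of assignments with domain `x 0, …, x (n - 1)`,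
satisfies `φ` in the model `M`. -/
def Sat {L : FirstOrder.Language.{u, v}} (M : Type w) [L.Structure M] :
    {n : ℕ} → TeamFormula L n → Set (Fin n → M) → Prop
  | _, eq t₁ t₂, X => ∀ s ∈ X, t₁.realize s = t₂.realize s
  | _, ne t₁ t₂, X => ∀ s ∈ X, t₁.realize s ≠ t₂.realize s
  | _, rel R t, X => ∀ s ∈ X, FirstOrder.Language.Structure.RelMap R (fun i => (t i).realize s)
  | _, nrel R t, X => ∀ s ∈ X, ¬ FirstOrder.Language.Structure.RelMap R (fun i => (t i).realize s)
  | _, incl t₁ t₂, X => ∀ s ∈ X, ∃ s' ∈ X, ∀ i, (t₁ i).realize s = (t₂ i).realize s'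
  | _, or φ ψ, X => ∃ Y Z, X = Y ∪ Z ∧ Sat M φ Y ∧ Sat M ψ Z
  | _, and φ ψ, X => Sat M φ X ∧ Sat M ψ X
  | n, ex φ, X => ∃ H : (Fin n → M) → Set M, (∀ s ∈ X, (H s).Nonempty) ∧ Sat M φ (supplement X H)
  | _, all φ, X => Sat M φ (duplicate X)
  | _, flat φ, X => ∀ s ∈ X, Sat M φ {s}

/-- A sentence is true in `M` if it is satisfied by the team containing only the empty
assignment. -/
def TrueIn {L : FirstOrder.Language.{u, v}} (M : Type w) [L.Structure M]
    (φ : TeamFormula L 0) : Prop :=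
  Sat M φ {Fin.elim0}

/-- Every inclusion atom of the formula has arity at most `k`. -/
def InclArityLE {L : FirstOrder.Language.{u, v}} (k : ℕ) : {n : ℕ} → TeamFormula L n → Prop
  | _, eq _ _ => True
  | _, ne _ _ => True
  | _, rel _ _ => True
  | _, nrel _ _ => True
  | _, incl (k := j) _ _ => j ≤ k
  | _, or φ ψ => InclArityLE k φ ∧ InclArityLE k ψ
  | _, and φ ψ => InclArityLE k φ ∧ InclArityLE k ψ
  | _, ex φ => InclArityLE k φ
  | _, all φ => InclArityLE k φ
  | _, flat φ => InclArityLE k φ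

/-- The flattening operator does not occur in the formula. -/
def FlatFree {L : FirstOrder.Language.{u, v}} : {n : ℕ} → TeamFormula L n → Prop
  | _, eq _ _ => True
  | _, ne _ _ => True
  | _, rel _ _ => True
  | _, nrel _ _ => True
  | _, incl _ _ => True
  | _, or φ ψ => FlatFree φ ∧ FlatFree ψ
  | _, and φ ψ => FlatFree φ ∧ FlatFree ψ
  | _, ex φ => FlatFree φ
  | _, all φ => FlatFree φ
  | _, flat _ => False

end TeamFormula

/-- `k`-ary inclusion logic `FO(⊆ₖ)` over `L`: its formulas in `n` free variables. -/
def FOIncl (L : FirstOrder.Language.{u, v}) (k n : ℕ) : Set (TeamFormula L n) :=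
  {φ | φ.InclArityLE k ∧ φ.FlatFree}

/-- `k`-ary inclusion logic with the flattening operator, `FO(⊆ₖ, F)`, over `L`. -/
def FOInclF (L : FirstOrder.Language.{u, v}) (k n : ℕ) : Set (TeamFormula L n) :=
  {φ | φ.InclArityLE k}

/-- Every formula of the logic `A` is equivalent to a formula of the logic `B`. -/
def FormulasLE {L : FirstOrder.Language.{u, v}} (A B : (n : ℕ) → Set (TeamFormula L n)) : Prop :=
  ∀ n, ∀ φ ∈ A n, ∃ ψ ∈ B n, ∀ (M : Type w) [Nonempty M] [L.Structure M] (X : Set (Fin n → M)),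
    φ.Sat M X ↔ ψ.Sat M X

/-- Every sentence of the logic `A` is equivalent to a sentence of the logic `B`. -/
def SentencesLE {L : FirstOrder.Language.{u, v}} (A B : (n : ℕ) → Set (TeamFormula L n)) : Prop :=
  ∀ φ ∈ A 0, ∃ ψ ∈ B 0, ∀ (M : Type w) [Nonempty M] [L.Structure M], φ.TrueIn M ↔ ψ.TrueIn M

/-- Truth of a sentence in a graph `G = ⟨V, E⟩`, where `E` is the adjacency relation. -/
def SimpleGraph.Models {V : Type w} (G : SimpleGraph V)
    (φ : TeamFormula FirstOrder.Language.graph 0) : Prop :=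
  @TeamFormula.TrueIn FirstOrder.Language.graph V G.structure φ

/-! If automorphisms act transitively on a structure, every term takes all values on a nonempty
automorphism-closed team, so unary inclusion atoms hold there for free. A sentence of unary
inclusion logic then agrees with the first-order sentence got by erasing its atoms
(`trueIn_iff_pointSat`). The graphs on ℤ/2m joining elements that differ by 1, respectively by 2,
are both transitive, and for large m the Ehrenfeucht–Fraïssé game does not separate them
(`pointSat_circulantGraph_iff`); only the first is connected. With `F`, one vertex z can be held
fixed while the values of x form a nonempty edge-closed set avoiding z (`models_disconnected_iff`).
Strictness follows from these two facts. -/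

/-- A term over a relational signature is a variable. -/
theorem FirstOrder.Language.Term.exists_realize_eq_apply {L : FirstOrder.Language.{u, v}}
    [L.IsRelational] {α : Type*} (t : L.Term α) :
    ∃ i, ∀ (M : Type w) [L.Structure M] (s : α → M), t.realize s = s i := by
  cases t with
  | var i => exact ⟨i, fun _ _ _ => rfl⟩
  | func f _ => exact isEmptyElim f

/-! ### First-order erasure, transitive structures, back-and-forth systems -/

namespace TeamFormula

section PointSat

open scoped FirstOrder

variable {L : FirstOrder.Language.{u, v}}

/-- Satisfaction of the first-order formula obtained from a team formula by erasing the operator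
`F` and replacing the inclusion atoms by a tautology. -/
def PointSat (M : Type w) [L.Structure M] : {n : ℕ} → TeamFormula L n → (Fin n → M) → Prop
  | _, eq t₁ t₂, s => t₁.realize s = t₂.realize s
  | _, ne t₁ t₂, s => t₁.realize s ≠ t₂.realize s
  | _, rel R t, s => FirstOrder.Language.Structure.RelMap R (fun i => (t i).realize s)
  | _, nrel R t, s => ¬ FirstOrder.Language.Structure.RelMap R (fun i => (t i).realize s)
  | _, incl _ _, _ => True
  | _, or φ ψ, s => PointSat M φ s ∨ PointSat M ψ s
  | _, and φ ψ, s => PointSat M φ s ∧ PointSat M ψ s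
  | n, ex φ, s => ∃ m : M, PointSat M φ (Fin.snoc (α := fun _ => M) s m : Fin (n + 1) → M)
  | n, all φ, s => ∀ m : M, PointSat M φ (Fin.snoc (α := fun _ => M) s m : Fin (n + 1) → M)
  | _, flat φ, s => PointSat M φ s

/-- The quantifier rank of a team formula. -/
def quantifierRank : {n : ℕ} → TeamFormula L n → ℕ
  | _, eq _ _ => 0
  | _, ne _ _ => 0
  | _, rel _ _ => 0
  | _, nrel _ _ => 0
  | _, incl _ _ => 0
  | _, or φ ψ => max φ.quantifierRank ψ.quantifierRank
  | _, and φ ψ => max φ.quantifierRank ψ.quantifierRank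
  | _, ex φ => φ.quantifierRank + 1
  | _, all φ => φ.quantifierRank + 1
  | _, flat φ => φ.quantifierRank

variable {M : Type w} [L.Structure M]

/-- Erasure only weakens a formula, and every team clause passes down to single assignments; no
transitivity is needed in this direction. -/
theorem Sat.pointSat {n : ℕ} {φ : TeamFormula L n} {X : Set (Fin n → M)} (h : φ.Sat M X)
    {s : Fin n → M} (hs : s ∈ X) : φ.PointSat M s := by
  induction φ with
  | eq => exact h s hs
  | ne => exact h s hs
  | rel => exact h s hs
  | nrel => exact h s hs
  | incl => trivial
  | or φ ψ ihφ ihψ =>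
    obtain ⟨Y, Z, rfl, hY, hZ⟩ := h
    exact hs.imp (ihφ hY) (ihψ hZ)
  | and φ ψ ihφ ihψ => exact ⟨ihφ h.1 hs, ihψ h.2 hs⟩
  | ex φ ih =>
    obtain ⟨H, hne, hH⟩ := h
    obtain ⟨m, hm⟩ := hne s hs
    exact ⟨m, ih hH ⟨s, hs, m, hm, rfl⟩⟩
  | all φ ih => exact fun m => ih h ⟨s, hs, m, rfl⟩
  | flat φ ih => exact ih (h s hs) rfl

theorem pointSat_comp_equiv (f : M ≃[L] M) {n : ℕ} (φ : TeamFormula L n) (s : Fin n → M) :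
    φ.PointSat M (f ∘ s) ↔ φ.PointSat M s := by
  induction φ with
  | eq => simp [PointSat]
  | ne => simp [PointSat]
  | rel R t =>
    simp only [PointSat, FirstOrder.Language.HomClass.realize_term]
    exact FirstOrder.Language.StrongHomClass.map_rel f R _
  | nrel R t =>
    simp only [PointSat, FirstOrder.Language.HomClass.realize_term]
    exact not_congr (FirstOrder.Language.StrongHomClass.map_rel f R _)
  | incl => rfl
  | or φ ψ ihφ ihψ => exact or_congr (ihφ s) (ihψ s)
  | and φ ψ ihφ ihψ => exact and_congr (ihφ s) (ihψ s)
  | ex φ ih =>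
    refine (f.toEquiv.surjective.exists).trans (exists_congr fun m => ?_)
    rw [← ih (Fin.snoc s m), Fin.comp_snoc]
    rfl
  | all φ ih =>
    refine (f.toEquiv.surjective.forall).trans (forall_congr' fun m => ?_)
    rw [← ih (Fin.snoc s m), Fin.comp_snoc]
    rfl
  | flat φ ih => exact ih s

/-- On a structure whose automorphism group is transitive, a formula of unary inclusion logic is
first-order on the teams that are closed under automorphisms. -/
theorem sat_of_forall_pointSat (htrans : ∀ x y : M, ∃ f : M ≃[L] M, f x = y) {n : ℕ}
    {φ : TeamFormula L n} (hφ : φ ∈ FOIncl L 1 n) {X : Set (Fin n → M)}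
    (hX : ∀ f : M ≃[L] M, ∀ s ∈ X, f ∘ s ∈ X) (h : ∀ s ∈ X, φ.PointSat M s) : φ.Sat M X := by
  induction φ with
  | eq => exact h
  | ne => exact h
  | rel => exact h
  | nrel => exact h
  | @incl n k t₁ t₂ =>
    intro s hs
    have hk : k ≤ 1 := hφ.1
    rcases Nat.le_one_iff_eq_zero_or_eq_one.1 hk with rfl | rfl
    · exact ⟨s, hs, fun i => i.elim0⟩
    · obtain ⟨f, hf⟩ := htrans ((t₂ 0).realize s) ((t₁ 0).realize s)
      refine ⟨f ∘ s, hX f s hs, fun i => ?_⟩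
      rw [Subsingleton.elim i 0, FirstOrder.Language.HomClass.realize_term, hf]
  | or φ ψ ihφ ihψ =>
    -- The largest candidate subteams are definable, hence again closed under automorphisms.
    refine ⟨{s ∈ X | φ.PointSat M s}, {s ∈ X | ψ.PointSat M s}, ?_,
      ihφ ⟨hφ.1.1, hφ.2.1⟩ (fun f s hs => ⟨hX f s hs.1, ?_⟩) fun s hs => hs.2,
      ihψ ⟨hφ.1.2, hφ.2.2⟩ (fun f s hs => ⟨hX f s hs.1, ?_⟩) fun s hs => hs.2⟩
    · ext s
      exact ⟨fun hs => (h s hs).imp (⟨hs, ·⟩) (⟨hs, ·⟩), fun hs => hs.elim (·.1) (·.1)⟩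
    · exact (pointSat_comp_equiv f φ s).2 hs.2
    · exact (pointSat_comp_equiv f ψ s).2 hs.2
  | and φ ψ ihφ ihψ =>
    exact ⟨ihφ ⟨hφ.1.1, hφ.2.1⟩ hX fun s hs => (h s hs).1,
      ihψ ⟨hφ.1.2, hφ.2.2⟩ hX fun s hs => (h s hs).2⟩
  | ex φ ih =>
    -- Lax semantics allows all witnesses at once, so no choice breaks the symmetry.
    refine ⟨fun s => {m | φ.PointSat M (Fin.snoc (α := fun _ => M) s m)}, h,
      ih ⟨hφ.1, hφ.2⟩ ?_ ?_⟩
    · rintro f _ ⟨s, hs, m, hm, rfl⟩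
      refine ⟨f ∘ s, hX f s hs, f m, ?_, Fin.comp_snoc _ _ _⟩
      have := (pointSat_comp_equiv f φ _).2 hm
      rwa [Fin.comp_snoc] at this
    · rintro _ ⟨s, -, m, hm, rfl⟩
      exact hm
  | all φ ih =>
    refine ih ⟨hφ.1, hφ.2⟩ ?_ ?_
    · rintro f _ ⟨s, hs, m, rfl⟩
      exact ⟨f ∘ s, hX f s hs, f m, Fin.comp_snoc _ _ _⟩
    · rintro _ ⟨s, hs, m, rfl⟩
      exact h s hs m
  | flat => exact hφ.2.elim

theorem trueIn_iff_pointSat (htrans : ∀ x y : M, ∃ f : M ≃[L] M, f x = y) {φ : TeamFormula L 0}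
    (hφ : φ ∈ FOIncl L 1 0) : φ.TrueIn M ↔ φ.PointSat M Fin.elim0 := by
  refine ⟨fun h => h.pointSat rfl, fun h => sat_of_forall_pointSat htrans hφ
    (fun f s _ => Subsingleton.elim _ _) ?_⟩
  rintro _ rfl
  exact h

/-- A back-and-forth system between two relational structures, in which `R k` relates the tuples
from which `k` more rounds can be played, preserves satisfaction up to quantifier rank `k`. -/
theorem pointSat_iff_of_backAndForth [L.IsRelational] {N : Type w} [L.Structure N]
    {R : ℕ → ∀ {n : ℕ}, (Fin n → M) → (Fin n → N) → Prop}
    (heq : ∀ {k n : ℕ} {s : Fin n → M} {t : Fin n → N}, R k s t → ∀ i j, s i = s j ↔ t i = t j)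
    (hrel : ∀ {k n : ℕ} {s : Fin n → M} {t : Fin n → N}, R k s t →
      ∀ {l : ℕ} (P : L.Relations l) (a : Fin l → Fin n),
        FirstOrder.Language.Structure.RelMap P (s ∘ a) ↔
          FirstOrder.Language.Structure.RelMap P (t ∘ a))
    (hforth : ∀ {k n : ℕ} {s : Fin n → M} {t : Fin n → N}, R (k + 1) s t →
      ∀ x : M, ∃ y : N, R k (Fin.snoc (α := fun _ => M) s x) (Fin.snoc (α := fun _ => N) t y))
    (hback : ∀ {k n : ℕ} {s : Fin n → M} {t : Fin n → N}, R (k + 1) s t →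
      ∀ y : N, ∃ x : M, R k (Fin.snoc (α := fun _ => M) s x) (Fin.snoc (α := fun _ => N) t y))
    {k n : ℕ} {φ : TeamFormula L n} (hk : φ.quantifierRank ≤ k) {s : Fin n → M} {t : Fin n → N}
    (h : R k s t) : φ.PointSat M s ↔ φ.PointSat N t := by
  have heq' {k n : ℕ} {s : Fin n → M} {t : Fin n → N} (h : R k s t) (t₁ t₂ : L.Term (Fin n)) :
      t₁.realize s = t₂.realize s ↔ t₁.realize t = t₂.realize t := by
    obtain ⟨i, hi⟩ := t₁.exists_realize_eq_apply
    obtain ⟨j, hj⟩ := t₂.exists_realize_eq_apply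
    rw [hi, hi, hj, hj]
    exact heq h i j
  have hrel' {k n l : ℕ} {s : Fin n → M} {t : Fin n → N} (h : R k s t) (P : L.Relations l)
      (r : Fin l → L.Term (Fin n)) :
      FirstOrder.Language.Structure.RelMap P (fun i => (r i).realize s) ↔
        FirstOrder.Language.Structure.RelMap P (fun i => (r i).realize t) := by
    choose a ha using fun i => (r i).exists_realize_eq_apply
    rw [funext fun i => ha i M s, funext fun i => ha i N t]
    exact hrel h P a
  induction φ generalizing k with
  | eq t₁ t₂ => exact heq' h t₁ t₂
  | ne t₁ t₂ => exact not_congr (heq' h t₁ t₂)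
  | rel P r => exact hrel' h P r
  | nrel P r => exact not_congr (hrel' h P r)
  | incl => rfl
  | or φ ψ ihφ ihψ => exact or_congr (ihφ (le_of_max_le_left hk) h) (ihψ (le_of_max_le_right hk) h)
  | and φ ψ ihφ ihψ => exact and_congr (ihφ (le_of_max_le_left hk) h) (ihψ (le_of_max_le_right hk) h)
  | ex φ ih =>
    obtain ⟨k, rfl⟩ := Nat.exists_eq_add_of_le' (Nat.le_of_add_left_le hk)
    have hk' : φ.quantifierRank ≤ k := Nat.le_of_succ_le_succ hk
    constructor
    · rintro ⟨x, hx⟩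
      obtain ⟨y, hy⟩ := hforth h x
      exact ⟨y, (ih hk' hy).1 hx⟩
    · rintro ⟨y, hy⟩
      obtain ⟨x, hx⟩ := hback h y
      exact ⟨x, (ih hk' hx).2 hy⟩
  | all φ ih =>
    obtain ⟨k, rfl⟩ := Nat.exists_eq_add_of_le' (Nat.le_of_add_left_le hk)
    have hk' : φ.quantifierRank ≤ k := Nat.le_of_succ_le_succ hk
    constructor
    · intro hs y
      obtain ⟨x, hx⟩ := hback h y
      exact (ih hk' hx).1 (hs x)
    · intro ht x
      obtain ⟨y, hy⟩ := hforth h x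
      exact (ih hk' hy).2 (ht y)
  | flat φ ih => exact ih hk h

end PointSat

end TeamFormula

/-! ### Defining disconnectedness with flattening -/

theorem SimpleGraph.not_preconnected_iff_exists_closed {V : Type*} (G : SimpleGraph V) :
    ¬ G.Preconnected ↔
      ∃ z, ∃ S : Set V, S.Nonempty ∧ z ∉ S ∧ ∀ x ∈ S, ∀ y, G.Adj x y → y ∈ S := by
  constructor
  · intro h
    simp only [SimpleGraph.Preconnected, not_forall] at h
    obtain ⟨u, z, hz⟩ := h
    exact ⟨z, {y | G.Reachable u y}, ⟨u, .refl u⟩, hz,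
      fun x hx y hxy => SimpleGraph.Reachable.trans hx hxy.reachable⟩
  · rintro ⟨z, S, ⟨u, hu⟩, hz, hS⟩ h
    obtain ⟨p⟩ := h u z
    induction p with
    | nil => exact hz hu
    | cons hadj _ ih => exact ih (hS _ hu _ hadj) hz

namespace TeamFormula

open FirstOrder Language

/-- The sentence `∃ z F ∃ x (x ≠ z ∧ ∀ y (¬ E(x, y) ∨ y ⊆ x))`. -/
def disconnected : TeamFormula Language.graph 0 :=
  ex (flat (ex (and (ne (.var 1) (.var 0))
    (all (or (nrel adj ![.var 1, .var 2]) (incl ![.var 2] ![.var 1]))))))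

theorem models_disconnected_iff {V : Type w} [Nonempty V] (G : SimpleGraph V) :
    G.Models disconnected ↔ ¬ G.Connected := by
  rw [SimpleGraph.connected_iff, and_iff_left ‹_›, G.not_preconnected_iff_exists_closed]
  let := G.structure
  change (∃ H : (Fin 0 → V) → Set V, (∀ s ∈ ({Fin.elim0} : Set (Fin 0 → V)), (H s).Nonempty) ∧
    ∀ s ∈ supplement {Fin.elim0} H, ∃ H' : (Fin 1 → V) → Set V,
      (∀ s' ∈ ({s} : Set (Fin 1 → V)), (H' s').Nonempty) ∧
      (∀ s' ∈ supplement {s} H', s' 1 ≠ s' 0) ∧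
      ∃ Y Z, duplicate (supplement {s} H') = Y ∪ Z ∧ (∀ s' ∈ Y, ¬ G.Adj (s' 1) (s' 2)) ∧
        Sat V (incl ![.var 2] ![.var 1]) Z) ↔ _
  have hincl (Z : Set (Fin 3 → V)) :
      Sat V (incl (L := Language.graph) ![.var 2] ![.var 1]) Z ↔ ∀ s ∈ Z, ∃ s' ∈ Z, s 2 = s' 1 := by
    simp [Sat]
  simp only [hincl]
  constructor
  · rintro ⟨H, hne, hH⟩
    obtain ⟨z, hz⟩ := hne _ rfl
    obtain ⟨H', hne', hsep, Y, Z, hYZ, hY, hZ⟩ := hH _ ⟨_, rfl, z, hz, rfl⟩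
    refine ⟨z, H' _, hne' _ rfl, fun h => hsep _ ⟨_, rfl, z, h, rfl⟩ rfl, fun x hx y hxy => ?_⟩
    -- An edge from x to y forces the assignment into the part satisfying the atom, so y is a value
    -- of x. Flattening ensures that this value was chosen for the same z.
    have hmem := hYZ.subset ⟨_, ⟨_, rfl, x, hx, rfl⟩, y, rfl⟩
    obtain ⟨s', hs', hys⟩ := hZ _ (hmem.resolve_left fun h => hY _ h hxy)
    obtain ⟨_, ⟨_, rfl, x', hx', rfl⟩, y', rfl⟩ := hYZ.superset (.inr hs')
    have : y = x' := hys
    rwa [this]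
  · rintro ⟨z, S, hne, hz, hS⟩
    refine ⟨fun _ => {z}, fun _ _ => Set.singleton_nonempty z, ?_⟩
    rintro _ ⟨s, -, _, rfl, rfl⟩
    refine ⟨fun _ => S, fun _ _ => hne, ?_, _, _,
      (Set.inter_union_compl _ {s' : Fin 3 → V | ¬ G.Adj (s' 1) (s' 2)}).symm, fun _ h => h.2, ?_⟩
    · rintro _ ⟨_, rfl, x, hx, rfl⟩ (rfl : x = _)
      exact hz hx
    · rintro _ ⟨⟨_, ⟨_, rfl, x, hx, rfl⟩, y, rfl⟩, hxy⟩
      have hxy : G.Adj x y := not_not.1 hxy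
      -- The assignment with x and y swapped witnesses the atom; it lies in the same part because
      -- adjacency is symmetric.
      exact ⟨_, ⟨⟨_, ⟨_, rfl, y, hS x hx y hxy, rfl⟩, x, rfl⟩, not_not.2 hxy.symm⟩, rfl⟩

end TeamFormula

/-! ### Circulant graphs with one jump: the game and connectedness -/

section Circulant

open SimpleGraph FirstOrder Language

variable {A B : Type w} [AddCommGroup A] [AddCommGroup B]

theorem SimpleGraph.circulantGraph_singleton_adj {c x y : A} (hc : c ≠ 0) :
    (circulantGraph {c}).Adj x y ↔ y = x + c ∨ x = y + c := by
  rw [circulantGraph_adj]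
  simp only [Set.mem_singleton_iff, sub_eq_iff_eq_add']
  constructor
  · rintro ⟨-, h | h⟩
    · exact .inr h
    · exact .inl h
  · rintro (rfl | rfl) <;> simp [hc]

theorem SimpleGraph.circulantGraph_structure_transitive (s : Set A) (x y : A) :
    letI := (circulantGraph s).structure
    ∃ f : A ≃[Language.graph] A, f x = y := by
  let := (circulantGraph s).structure
  refine ⟨⟨Equiv.addRight (y - x), fun f => isEmptyElim f, ?_⟩, add_sub_cancel _ _⟩
  rintro _ ⟨⟩ v
  exact circulantGraph_adj_translate

/-- The tuples `s` and `t` have the same differences among the multiples `d • a` and `d • b` with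
`|d| ≤ 2 ^ k`. -/
def SameShortDifferences (a : A) (b : B) (k : ℕ) {n : ℕ} (s : Fin n → A) (t : Fin n → B) : Prop :=
  ∀ i j, ∀ d : ℤ, |d| ≤ 2 ^ k → (s j = s i + d • a ↔ t j = t i + d • b)

theorem SameShortDifferences.symm {a : A} {b : B} {k n : ℕ} {s : Fin n → A} {t : Fin n → B}
    (h : SameShortDifferences a b k s t) : SameShortDifferences b a k t s :=
  fun i j d hd => (h i j d hd).symm

/-- One move of the game, halving the radius of visible differences. A point near an old one is
copied by the same offset; a far one is answered by a point outside all balls around the old points,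
which exists by counting. -/
theorem SameShortDifferences.exists_snoc {a : A} {b : B} {k n : ℕ} {s : Fin n → A} {t : Fin n → B}
    (h : SameShortDifferences a b (k + 1) s t)
    (ha : ∀ d : ℤ, |d| ≤ 2 ^ k → d • a = 0 → d = 0) (hb : ∀ d : ℤ, |d| ≤ 2 ^ k → d • b = 0 → d = 0)
    (hcard : n * (2 ^ (k + 1) + 1) < Nat.card B) (x : A) :
    ∃ y : B, SameShortDifferences a b k (Fin.snoc (α := fun _ => A) s x)
      (Fin.snoc (α := fun _ => B) t y) := by
  have hself (x : A) (y : B) (d : ℤ) (hd : |d| ≤ 2 ^ k) : x = x + d • a ↔ y = y + d • b := by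
    rw [left_eq_add, left_eq_add]
    constructor <;> intro h0
    · rw [ha d hd h0, zero_smul]
    · rw [hb d hd h0, zero_smul]
  suffices ∃ y : B, ∀ j, ∀ d : ℤ, |d| ≤ 2 ^ k → (s j = x + d • a ↔ t j = y + d • b) by
    obtain ⟨y, hy⟩ := this
    refine ⟨y, fun i j d hd => ?_⟩
    induction i using Fin.lastCases with
    | last =>
      induction j using Fin.lastCases with
      | last => simpa only [Fin.snoc_last] using hself x y d hd
      | cast j => simpa only [Fin.snoc_last, Fin.snoc_castSucc] using hy j d hd
    | cast i =>
      induction j using Fin.lastCases with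
      | last =>
        have := hy i (-d) (by rwa [abs_neg])
        simp only [neg_smul, ← sub_eq_add_neg, eq_sub_iff_add_eq] at this
        simpa only [Fin.snoc_last, Fin.snoc_castSucc, eq_comm] using this
      | cast j =>
        simpa only [Fin.snoc_castSucc] using h i j d (hd.trans (pow_le_pow_right₀ one_le_two k.le_succ))
  by_cases hx : ∃ i, ∃ e : ℤ, |e| ≤ 2 ^ k ∧ x = s i + e • a
  · obtain ⟨i, e, he, rfl⟩ := hx
    refine ⟨t i + e • b, fun j d hd => ?_⟩
    rw [add_assoc, add_assoc, ← add_smul, ← add_smul]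
    -- Two offsets of size at most `2 ^ k` add up to at most `2 ^ (k + 1)`.
    refine h i j _ ((abs_add_le _ _).trans ?_)
    rw [pow_succ, mul_two]
    exact add_le_add he hd
  · have : ∃ y : B, ∀ i, ∀ e : ℤ, |e| ≤ 2 ^ k → y ≠ t i + e • b := by
      let g : Fin n × Finset.Icc (-2 ^ k : ℤ) (2 ^ k) → B := fun p => t p.1 + (p.2 : ℤ) • b
      have hg : ¬ Function.Surjective g := by
        intro hg
        refine hcard.not_ge ((Nat.card_le_card_of_surjective g hg).trans_eq ?_)
        rw [Nat.card_prod, Nat.card_fin, Nat.card_eq_fintype_card, Fintype.card_coe, Int.card_Icc]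
        congr 1
        rw [← Int.toNat_natCast (2 ^ (k + 1) + 1)]
        push_cast
        ring_nf
      simp only [Function.Surjective, not_forall, not_exists] at hg
      obtain ⟨y, hy⟩ := hg
      exact ⟨y, fun i e he h' => hy (i, ⟨e, Finset.mem_Icc.2 (abs_le.1 he)⟩) h'.symm⟩
    obtain ⟨y, hy⟩ := this
    refine ⟨y, fun j d hd => iff_of_false (fun h' => hx ⟨j, -d, by rwa [abs_neg], ?_⟩) fun h' =>
      hy j (-d) (by rwa [abs_neg]) ?_⟩ <;> simp [h']

/-- Circulant graphs with a single jump of large order are indistinguishable by first-order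
sentences of small quantifier rank. -/
theorem TeamFormula.pointSat_circulantGraph_iff {a : A} {b : B} {K : ℕ}
    (ha : ∀ d : ℤ, |d| ≤ 2 ^ K → d • a = 0 → d = 0) (hb : ∀ d : ℤ, |d| ≤ 2 ^ K → d • b = 0 → d = 0)
    (hA : K * (2 ^ K + 1) < Nat.card A) (hB : K * (2 ^ K + 1) < Nat.card B)
    {φ : TeamFormula Language.graph 0} (hφ : φ.quantifierRank ≤ K) :
    @PointSat _ A (circulantGraph {a}).structure _ φ Fin.elim0 ↔
      @PointSat _ B (circulantGraph {b}).structure _ φ Fin.elim0 := by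
  let := (circulantGraph {a}).structure
  let := (circulantGraph {b}).structure
  have ha0 : a ≠ 0 := fun h => one_ne_zero (ha 1 (by simpa using one_le_pow₀ one_le_two) (by simp [h]))
  have hb0 : b ≠ 0 := fun h => one_ne_zero (hb 1 (by simpa using one_le_pow₀ one_le_two) (by simp [h]))
  have hle {k n : ℕ} (hk : k + 1 + n ≤ K) : (2 : ℤ) ^ k ≤ 2 ^ K :=
    pow_le_pow_right₀ one_le_two (by omega)
  have hcard {k n : ℕ} (hk : k + 1 + n ≤ K) : n * (2 ^ (k + 1) + 1) ≤ K * (2 ^ K + 1) :=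
    Nat.mul_le_mul (by omega) (Nat.add_le_add_right (Nat.pow_le_pow_right two_pos (by omega)) 1)
  -- Bounding rounds left plus points placed by `K` makes the single cardinality bound suffice for
  -- every move. Differences 0 and 1 encode equality and adjacency.
  refine pointSat_iff_of_backAndForth
    (R := fun k n s t => k + n ≤ K ∧ SameShortDifferences a b k s t) ?_ ?_ ?_ ?_ hφ
    ⟨le_rfl, fun i => i.elim0⟩
  · rintro k n s t ⟨-, h⟩ i j
    simpa [eq_comm] using h j i 0 (by simp)
  · rintro k n s t ⟨-, h⟩ _ ⟨⟩ v
    have key (i j : Fin n) : s j = s i + a ↔ t j = t i + b := by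
      simpa using h i j 1 (by simpa using one_le_pow₀ one_le_two)
    change (circulantGraph {a}).Adj (s (v 0)) (s (v 1)) ↔ (circulantGraph {b}).Adj (t (v 0)) (t (v 1))
    rw [circulantGraph_singleton_adj ha0, circulantGraph_singleton_adj hb0, key, key]
  · rintro k n s t ⟨hk, h⟩ x
    obtain ⟨y, hy⟩ := h.exists_snoc (fun d hd => ha d (hd.trans (hle hk)))
      (fun d hd => hb d (hd.trans (hle hk))) ((hcard hk).trans_lt hB) x
    exact ⟨y, by omega, hy⟩
  · rintro k n s t ⟨hk, h⟩ y
    obtain ⟨x, hx⟩ := h.symm.exists_snoc (fun d hd => hb d (hd.trans (hle hk)))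
      (fun d hd => ha d (hd.trans (hle hk))) ((hcard hk).trans_lt hA) y
    exact ⟨x, by omega, hx.symm⟩

theorem SimpleGraph.circulantGraph_singleton_preconnected {a : A}
    (h : ∀ x : A, ∃ d : ℕ, x = d • a) : (circulantGraph {a}).Preconnected := by
  have hzero (d : ℕ) : (circulantGraph {a}).Reachable 0 (d • a) := by
    induction d with
    | zero => simp
    | succ d ih =>
      rcases eq_or_ne a 0 with rfl | ha
      · simp
      · exact ih.trans ((circulantGraph_singleton_adj ha).2 (.inl (succ_nsmul a d))).reachable
  intro x y
  obtain ⟨d, rfl⟩ := h x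
  obtain ⟨e, rfl⟩ := h y
  exact (hzero d).symm.trans (hzero e)

/-- Edges move by `a` or `-a`, so `f` is constant on components. -/
theorem SimpleGraph.circulantGraph_singleton_not_preconnected {C : Type*} [AddCommGroup C] {a : A}
    (f : A →+ C) (ha : f a = 0) {x : A} (hx : f x ≠ 0) : ¬ (circulantGraph {a}).Preconnected := by
  refine (not_preconnected_iff_exists_closed _).2 ⟨x, {y | f y = 0}, ⟨0, map_zero f⟩, hx, ?_⟩
  intro y hy z hyz
  have hy : f y = 0 := hy
  rw [circulantGraph_adj] at hyz
  obtain ⟨-, h | h⟩ := hyz <;> simpa [ha, hy] using congrArg f (Set.mem_singleton_iff.1 h)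

theorem TeamFormula.models_circulantGraph_iff {a : A} {b : B} {φ : TeamFormula Language.graph 0}
    (hφ : φ ∈ FOIncl Language.graph 1 0) {K : ℕ} (hK : φ.quantifierRank ≤ K)
    (ha : ∀ d : ℤ, |d| ≤ 2 ^ K → d • a = 0 → d = 0) (hb : ∀ d : ℤ, |d| ≤ 2 ^ K → d • b = 0 → d = 0)
    (hA : K * (2 ^ K + 1) < Nat.card A) (hB : K * (2 ^ K + 1) < Nat.card B) :
    (circulantGraph {a}).Models φ ↔ (circulantGraph {b}).Models φ := by
  let := (circulantGraph {a}).structure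
  let := (circulantGraph {b}).structure
  exact (trueIn_iff_pointSat (circulantGraph_structure_transitive {a}) hφ).trans
    ((pointSat_circulantGraph_iff ha hb hA hB hK).trans
      (trueIn_iff_pointSat (circulantGraph_structure_transitive {b}) hφ).symm)

/-- Unary inclusion logic does not define disconnectedness on finite graphs. -/
theorem TeamFormula.not_exists_foIncl_disconnected :
    ¬ ∃ ψ ∈ FOIncl Language.graph 1 0, ∀ (V : Type w) [Nonempty V] [Finite V] (G : SimpleGraph V),
      G.Models ψ ↔ ¬ G.Connected := by
  rintro ⟨ψ, hψ, h⟩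
  set K := ψ.quantifierRank
  -- Large enough that neither 1 nor 2 is killed modulo `2 * m` by a nonzero `d` with `|d| ≤ 2 ^ K`,
  -- and that the balls in the game cannot cover the group.
  let m := (K + 1) * (2 ^ K + 1)
  have hm : 2 ^ K < m := by
    have : 1 * (2 ^ K + 1) ≤ m := Nat.mul_le_mul_right _ (by omega)
    exact (one_mul (2 ^ K + 1)).symm.trans_le this
  have hmK : K * (2 ^ K + 1) < m := Nat.mul_lt_mul_of_pos_right K.lt_succ_self (Nat.succ_pos _)
  have : NeZero (2 * m) := ⟨(Nat.mul_pos two_pos (Nat.zero_lt_of_lt hm)).ne'⟩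
  let A := ULift.{w} (ZMod (2 * m))
  have hcard : K * (2 ^ K + 1) < Nat.card A := by
    rw [Nat.card_congr Equiv.ulift, Nat.card_zmod]
    omega
  have hsmul (d : ℤ) (c : ℕ) : d • (⟨c⟩ : A) = 0 ↔ ((2 * m : ℕ) : ℤ) ∣ d * c := by
    rw [← ZMod.intCast_zmod_eq_zero_iff_dvd, ULift.ext_iff]
    simp
  have hfree (c : ℕ) (hc : 0 < c) (hc' : c ≤ 2) (d : ℤ) (hd : |d| ≤ 2 ^ K)
      (h0 : d • (⟨c⟩ : A) = 0) : d = 0 := by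
    have hd' : |d * c| < ((2 * m : ℕ) : ℤ) := by
      rw [abs_mul, Nat.abs_cast, mul_comm]
      push_cast
      have h1 : (2 ^ K : ℤ) < m := by exact_mod_cast hm
      have h2 : (c : ℤ) ≤ 2 := by exact_mod_cast hc'
      exact (mul_le_mul_of_nonneg_right h2 (abs_nonneg d)).trans_lt
        (mul_lt_mul_of_pos_left (hd.trans_lt h1) two_pos)
    have := Int.eq_zero_of_abs_lt_dvd ((hsmul d c).1 h0) hd'
    simpa [hc.ne'] using this
  have hiff := models_circulantGraph_iff hψ le_rfl (hfree 1 one_pos one_le_two)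
    (hfree 2 two_pos le_rfl) hcard hcard
  rw [h, h, not_iff_not] at hiff
  have h1 : (circulantGraph {(⟨(1 : ℕ)⟩ : A)}).Connected :=
    ⟨circulantGraph_singleton_preconnected fun x => ⟨x.down.val, ULift.ext _ _ <| by
      change x.down = x.down.val • ((1 : ℕ) : ZMod (2 * m))
      simp⟩⟩
  -- Parity is the invariant: jumps by 2 preserve it.
  refine circulantGraph_singleton_not_preconnected
    ((ZMod.castHom (dvd_mul_right 2 m) (ZMod 2)).toAddMonoidHom.comp
      (AddEquiv.ulift (α := ZMod (2 * m))).toAddMonoidHom) ?_ (x := ⟨1⟩) ?_ (hiff.1 h1).preconnected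
  · change ZMod.castHom (dvd_mul_right 2 m) (ZMod 2) ((2 : ℕ) : ZMod (2 * m)) = 0
    rw [map_natCast, ZMod.natCast_self]
  · change ZMod.castHom (dvd_mul_right 2 m) (ZMod 2) (1 : ZMod (2 * m)) ≠ 0
    rw [map_one]
    exact one_ne_zero

end Circulant

theorem mainTheorem4 :
    -- flattening increases expressive power: it loses nothing over any signature ...
    (∀ L : FirstOrder.Language.{u, v}, FormulasLE.{u, v, w} (FOIncl L 1) (FOInclF L 1)) ∧
    -- ... and is strictly more expressive, already for sentences over the signature of graphs
    ¬ SentencesLE.{0, 0, w} (FOInclF FirstOrder.Language.graph 1) (FOIncl FirstOrder.Language.graph 1) ∧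
    -- disconnectedness is expressible with flattening, on all graphs
    (∃ φ ∈ FOInclF FirstOrder.Language.graph 1 0, ∀ (V : Type w) [Nonempty V] (G : SimpleGraph V),
      G.Models φ ↔ ¬ G.Connected) ∧
    -- and not expressible without it, even on finite graphs
    ¬ ∃ ψ ∈ FOIncl FirstOrder.Language.graph 1 0, ∀ (V : Type w) [Nonempty V] [Finite V] (G : SimpleGraph V),
      G.Models ψ ↔ ¬ G.Connected := by
  have hdisc : ∃ φ ∈ FOInclF FirstOrder.Language.graph 1 0,
      ∀ (V : Type w) [Nonempty V] (G : SimpleGraph V), G.Models φ ↔ ¬ G.Connected :=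
    ⟨.disconnected, by simp [FOInclF, TeamFormula.disconnected, TeamFormula.InclArityLE],
      fun V _ G => TeamFormula.models_disconnected_iff G⟩
  refine ⟨fun L n φ hφ => ⟨φ, hφ.1, fun M _ _ X => Iff.rfl⟩, fun hle => ?_, hdisc,
    TeamFormula.not_exists_foIncl_disconnected⟩
  obtain ⟨φ, hφ, h⟩ := hdisc
  obtain ⟨ψ, hψ, hφψ⟩ := hle φ hφ
  exact TeamFormula.not_exists_foIncl_disconnected
    ⟨ψ, hψ, fun V _ _ G => (@hφψ V _ G.structure).symm.trans (h V G)⟩
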